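/- **Setting.** A state is ${\bf U}=(\rho,{\bf m},{\bf B},E)$ with $\rho,E\in\mathbb R$, ${\bf m},{\bf B}\in\mathbb R^3$; put ${\bf v}={\bf m}/\rho$, $\mathcal E({\bf U})=E-\frac12\big(\frac{|{\bf m}|^2}{\rho}+|{\bf B}|^2\big)$, $e=\mathcal E({\bf U})/\rho$, $p=p(\rho,e)$ with an equation of state such that for $\rho>0$ one has $e>0\Leftrightarrow p(\rho,e)>0$, and $p_{\rm tot}=p+\frac12|{\bf B}|^2$. The set of admissible states is $\mathcal G=\{{\bf U}:\rho>0,\ \mathcal E({\bf U})>0\}$. For $i=1,2$ let $${\bf F}_i({\bf U})=\big(\rho v_i,\ \rho v_i{\bf v}-B_i{\bf B}+p_{\rm tot}{\bf e}_i,\ v_i{\bf B}-B_i{\bf v},\ v_i(E+p_{\rm tot})-B_i({\bf v}\cdot{\bf B})\big),$$ where ${\bf e}_i$ is the $i$th unit vector of $\mathbb R^3$. For $\boldsymbol\xi\in\mathbb R^2$ write $\langle\boldsymbol\xi,{\bf w}\rangle=\xi_1w_1+\xi_2w_2$ (${\bf w}\in\mathbb R^3$) and $\langle\boldsymbol\xi,{\bf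 F}\rangle=\xi_1{\bf F}_1+\xi_2{\bf F}_2$. With $\mathscr C_s=\frac{p}{\rho\sqrt{2e}}$ let $$\mathscr C({\bf U};\boldsymbol\xi)=\tfrac1{\sqrt2}\Big[\mathscr C_s^2+\tfrac{|{\bf B}|^2}{\rho}+\sqrt{\big(\mathscr C_s^2+\tfrac{|{\bf B}|^2}{\rho}\big)^2-4\tfrac{\mathscr C_s^2\langle\boldsymbol\xi,{\bf B}\rangle^2}{\rho}}\Big]^{1/2},\qquad {\bf v}({\bf U},\tilde{\bf U})=\frac{\sqrt\rho\,{\bf v}+\sqrt{\tilde\rho}\,\tilde{\bf v}}{\sqrt\rho+\sqrt{\tilde\rho}},$$ $$\alpha_r({\bf U},\tilde{\bf U};\boldsymbol\xi)=\max\{\langle\boldsymbol\xi,{\bf v}\rangle,\langle\boldsymbol\xi,{\bf v}({\bf U},\tilde{\bf U})\rangle\}+\mathscr C({\bf U};\boldsymbol\xi)+\frac{|{\bf B}-\tilde{\bf B}|}{\sqrt\rho+\sqrt{\tilde\rho}},$$ $$\alpha_l({\bf U},\tilde{\bf U};\boldsymbol\xi)=\min\{\langle\boldsymbol\xi,{\bf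 v}\rangle,\langle\boldsymbol\xi,{\bf v}({\bf U},\tilde{\bf U})\rangle\}-\mathscr C({\bf U};\boldsymbol\xi)-\frac{|{\bf B}-\tilde{\bf B}|}{\sqrt\rho+\sqrt{\tilde\rho}}.$$ Given wave speeds $\sigma_l<\sigma_r$, functions of $({\bf U}^-,{\bf U}^+;\boldsymbol\xi)$, put $\sigma^+=\max\{\sigma_r,0\}$ and $\sigma^-=\min\{\sigma_l,0\}$. The HLL flux is $$\hat{\bf F}({\bf U}^-,{\bf U}^+;\boldsymbol\xi)=\frac{\sigma^+\langle\boldsymbol\xi,{\bf F}({\bf U}^-)\rangle-\sigma^-\langle\boldsymbol\xi,{\bf F}({\bf U}^+)\rangle+\sigma^-\sigma^+({\bf U}^+-{\bf U}^-)}{\sigma^+-\sigma^-}.$$ **Mesh and quadratures.** Let $\mathcal T_h$ be a mesh of non-overlapping polygonal cells (each bounded by a simple closed polygon, not necessarily convex) of a planar domain. The cell $K$ has area $|K|$ and edges $\mathscr E_K^j$, $1\le j\le N_K$, of lengths $|\mathscr E_K^j|$ and outward unit normals $\boldsymbol\xi_K^{(j)}$; put $|\partial K|=\sum_j|\mathscr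 E_K^j|$. Each edge is shared with an adjacent cell or lies on the boundary of the domain. Let $k\ge0$. On the edges a $Q$-point quadrature with points ${\bf x}_K^{(jq)}\in\mathscr E_K^j$ and weights $\omega_q>0$ (normalized to unit edge length) is given, exact for polynomials of degree at most $2k$ and with the same points and weights, up to numbering, for the two cells sharing an edge (for example Gauss quadrature with $Q=k+1$). Moreover, each cell has a quadrature with weights $\varpi_{jq},\widetilde\varpi_q>0$, $$\frac1{|K|}\int_Ku\,d{\bf x}=\sum_{j=1}^{N_K}\sum_{q=1}^Q\varpi_{jq}u({\bf x}_K^{(jq)})+\sum_{q=1}^{\widetilde Q}\widetilde\varpi_qu(\widetilde{\bf x}_K^{(q)})\quad\text{for all polynomials }u\text{ of degree at most }k,$$ where the $\widetilde{\bf x}_K^{(q)}\in K$ are finitely many (possibly no) further nodes. Let $\mathbb S_K$ be the set of all its nodes ${\bf x}_K^{(jq)}$, $\widetilde{\bf x}_K^{(q)}$. **Scheme.** For each $K$ let $\widetilde{\bf U}_K^n$ be a vector of polynomials of degree at most $k$ with cell average $\bar{\bf U}_K^n$ over $K$. Put ${\bf U}_{jq}^{{\rm int}(K)}=\widetilde{\bf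 U}_K^n({\bf x}_K^{(jq)})$, and let ${\bf U}_{jq}^{{\rm ext}(K)}$ be the value at ${\bf x}_K^{(jq)}$ of the polynomial vector of the adjacent cell sharing $\mathscr E_K^j$ or, on a boundary edge, a prescribed state in $\mathcal G$. Put $\sigma_{jq}^{K,\pm}=\sigma^\pm({\bf U}_{jq}^{{\rm int}(K)},{\bf U}_{jq}^{{\rm ext}(K)};\boldsymbol\xi_K^{(j)})$. The conservative scheme without penalty term, with $\Delta t_n>0$, is $$\bar{\bf U}_K^{n+1}=\bar{\bf U}_K^n-\frac{\Delta t_n}{|K|}\sum_{j=1}^{N_K}\sum_{q=1}^Q|\mathscr E_K^j|\,\omega_q\,\hat{\bf F}\big({\bf U}_{jq}^{{\rm int}(K)},{\bf U}_{jq}^{{\rm ext}(K)};\boldsymbol\xi_K^{(j)}\big).$$ Omitting the superscript ${\rm int}(K)$ on the right, let $$\widehat\alpha_{jq}^{{\rm int}(K)}=\mathscr C({\bf U}_{jq};\boldsymbol\xi_K^{(j)})+\frac2{|\partial K|}\sum_{i=1}^{N_K}|\mathscr E_K^i|\frac{|{\bf B}_{jq}-{\bf B}_{iq}|}{\sqrt{\rho_{jq}}+\sqrt{\rho_{iq}}}+\max\Big\{\langle\boldsymbol\xi_K^{(j)},{\bf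 v}_{jq}\rangle,\ \frac1{|\partial K|}\sum_{i=1}^{N_K}|\mathscr E_K^i|\big\langle\boldsymbol\xi_K^{(j)}-\boldsymbol\xi_K^{(i)},{\bf v}({\bf U}_{jq},{\bf U}_{iq})\big\rangle\Big\}.$$ **Theorem.** Suppose that $\widetilde{\bf U}_K^n({\bf x})\in\mathcal G$ for all $K$ and all ${\bf x}\in\mathbb S_K$, and that for all $K,j,q$, with ${\bf U}^-={\bf U}_{jq}^{{\rm int}(K)}$, ${\bf U}^+={\bf U}_{jq}^{{\rm ext}(K)}$, $\boldsymbol\xi=\boldsymbol\xi_K^{(j)}$, the wave speeds satisfy $\sigma_r\ge\alpha_r({\bf U}^+,{\bf U}^-;\boldsymbol\xi)$ and $\sigma_l\le\alpha_l({\bf U}^-,{\bf U}^+;\boldsymbol\xi)$. If $$\Delta t_n\frac{|\mathscr E_K^j|}{|K|}\big(\widehat\alpha_{jq}^{{\rm int}(K)}-\sigma_{jq}^{K,-}\big)<\frac{\varpi_{jq}}{\omega_q}\qquad\text{for all }K\in\mathcal T_h,\ 1\le j\le N_K,\ 1\le q\le Q,$$ then, for every $K\in\mathcal T_h$, $\bar\rho_K^{n+1}>0$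 and $$\mathcal E(\bar{\bf U}_K^{n+1})>-\Delta t_n\,(\bar\rho_K^{n+1})^{-1}\,\big(\bar{\bf m}_K^{n+1}\cdot\bar{\bf B}_K^{n+1}\big)\,{\rm div}_K\widetilde{\bf B}_h^n,$$ where $${\rm div}_K\widetilde{\bf B}_h^n=\frac1{|K|}\sum_{j=1}^{N_K}\sum_{q=1}^Q|\mathscr E_K^j|\,\omega_q\Big\langle\boldsymbol\xi_K^{(j)},\frac{\sigma_{jq}^{K,+}{\bf B}_{jq}^{{\rm int}(K)}-\sigma_{jq}^{K,-}{\bf B}_{jq}^{{\rm ext}(K)}}{\sigma_{jq}^{K,+}-\sigma_{jq}^{K,-}}\Big\rangle.$$ Furthermore, if ${\rm div}_K\widetilde{\bf B}_h^n=0$, then $\bar{\bf U}_K^{n+1}\in\mathcal G$. -/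

import Mathlib

open MeasureTheory Filter Topology

noncomputable section

namespace MHD

/-- The plane containing the mesh. -/
abbrev Plane := EuclideanSpace ℝ (Fin 2)

/-- Velocities, momenta and magnetic fields have three components. -/
abbrev Vec3 := EuclideanSpace ℝ (Fin 3)

/-- Conservative vectors `(ρ, m, B, E)`. -/
abbrev State := ℝ × Vec3 × Vec3 × ℝ

/-! ### States, flux, wave speeds -/

/-- Density `ρ`. -/
def dens (U : State) : ℝ := U.1

/-- Momentum `m`. -/
def mom (U : State) : Vec3 := U.2.1

/-- Magnetic field `B`. -/
def mag (U : State) : Vec3 := U.2.2.1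

/-- Total energy `E`. -/
def ener (U : State) : ℝ := U.2.2.2

/-- Velocity `v = m / ρ`. -/
def vel (U : State) : Vec3 := (dens U)⁻¹ • mom U

/-- Internal energy `E - (|m|² / ρ + |B|²) / 2`. -/
def internalEnergy (U : State) : ℝ :=
  ener U - (‖mom U‖ ^ 2 / dens U + ‖mag U‖ ^ 2) / 2

/-- The set of physically admissible states. -/
def admissible : Set State := {U | 0 < dens U ∧ 0 < internalEnergy U}

/-- Specific internal energy `e`. -/
def specificEnergy (U : State) : ℝ := internalEnergy U / dens U

/-- The standing assumption on the equation of state `p = p(ρ, e)`: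
for positive density, `e` is positive exactly when the pressure is. -/
def IsEOS (p : ℝ → ℝ → ℝ) : Prop := ∀ ρ e : ℝ, 0 < ρ → (0 < e ↔ 0 < p ρ e)

/-- Gas pressure. -/
def pressure (p : ℝ → ℝ → ℝ) (U : State) : ℝ := p (dens U) (specificEnergy U)

/-- Total pressure `p + |B|² / 2`. -/
def totalPressure (p : ℝ → ℝ → ℝ) (U : State) : ℝ := pressure p U + ‖mag U‖ ^ 2 / 2

/-- The flux `F_i` in the `i`-th coordinate direction of the plane. -/
def flux (p : ℝ → ℝ → ℝ) (i : Fin 2) (U : State) : State :=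
  (dens U * vel U i.castSucc,
   (dens U * vel U i.castSucc) • vel U - mag U i.castSucc • mag U
     + totalPressure p U • EuclideanSpace.single i.castSucc (1 : ℝ),
   vel U i.castSucc • mag U - mag U i.castSucc • vel U,
   vel U i.castSucc * (ener U + totalPressure p U)
     - mag U i.castSucc * inner ℝ (vel U) (mag U))

/-- `⟨ξ, w⟩ = ξ₁ w₁ + ξ₂ w₂` for a planar direction `ξ` and a three-component vector `w`. -/
def pair (ξ : Plane) (w : Vec3) : ℝ := ∑ i : Fin 2, ξ i * w i.castSucc

/-- `⟨ξ, F(U)⟩ = ξ₁ F₁(U) + ξ₂ F₂(U)`. -/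
def normalFlux (p : ℝ → ℝ → ℝ) (ξ : Plane) (U : State) : State := ∑ i : Fin 2, ξ i • flux p i U

/-- `𝒞_s = p / (ρ √(2e))`. -/
def soundC (p : ℝ → ℝ → ℝ) (U : State) : ℝ :=
  pressure p U / (dens U * √(2 * specificEnergy U))

/-- The quantity `𝒞(U; ξ)`. -/
def waveC (p : ℝ → ℝ → ℝ) (U : State) (ξ : Plane) : ℝ :=
  1 / √2 * √(soundC p U ^ 2 + ‖mag U‖ ^ 2 / dens U
    + √((soundC p U ^ 2 + ‖mag U‖ ^ 2 / dens U) ^ 2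
        - 4 * (soundC p U ^ 2 * pair ξ (mag U) ^ 2 / dens U)))

/-- The average of the velocities of `U` and `V` with weights `√ρ`. -/
def roeVel (U V : State) : Vec3 :=
  (√(dens U) + √(dens V))⁻¹ • (√(dens U) • vel U + √(dens V) • vel V)

/-- `α_r(U, V; ξ)`. -/
def alphaR (p : ℝ → ℝ → ℝ) (U V : State) (ξ : Plane) : ℝ :=
  max (pair ξ (vel U)) (pair ξ (roeVel U V)) + waveC p U ξ
    + ‖mag U - mag V‖ / (√(dens U) + √(dens V))

/-- `α_l(U, V; ξ)`. -/
def alphaL (p : ℝ → ℝ → ℝ) (U V : State) (ξ : Plane) : ℝ :=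
  min (pair ξ (vel U)) (pair ξ (roeVel U V)) - waveC p U ξ
    - ‖mag U - mag V‖ / (√(dens U) + √(dens V))

/-- Estimates of the leftmost and rightmost wave speeds, as functions of the left state, the
right state and the direction. -/
structure WaveSpeeds where
  left : State → State → Plane → ℝ
  right : State → State → Plane → ℝ

/-- `σ⁺ = max {σ_r, 0}`. -/
def WaveSpeeds.plus (σ : WaveSpeeds) (Um Up : State) (ξ : Plane) : ℝ := max (σ.right Um Up ξ) 0

/-- `σ⁻ = min {σ_l, 0}`. -/
def WaveSpeeds.minus (σ : WaveSpeeds) (Um Up : State) (ξ : Plane) : ℝ := min (σ.left Um Up ξ) 0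

/-- The requirements on the wave speeds for the states `Um`, `Up` in the direction `ξ`. -/
def WaveSpeeds.SpeedCondition (σ : WaveSpeeds) (p : ℝ → ℝ → ℝ) (Um Up : State) (ξ : Plane) :
    Prop :=
  σ.left Um Up ξ < σ.right Um Up ξ ∧
    alphaR p Up Um ξ ≤ σ.right Um Up ξ ∧ σ.left Um Up ξ ≤ alphaL p Um Up ξ

/-- The HLL flux with left state `Um` and right state `Up` in the direction `ξ`. -/
def hllFlux (p : ℝ → ℝ → ℝ) (σ : WaveSpeeds) (Um Up : State) (ξ : Plane) : State :=
  (σ.plus Um Up ξ - σ.minus Um Up ξ)⁻¹ •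
    (σ.plus Um Up ξ • normalFlux p ξ Um - σ.minus Um Up ξ • normalFlux p ξ Up
      + (σ.minus Um Up ξ * σ.plus Um Up ξ) • (Up - Um))

/-! ### Polygonal cells and meshes -/

/-- The point with parameter `t` on the segment from the `j`-th to the next vertex. -/
def edgePoint {n : ℕ} (v : Fin n → Plane) (j : Fin n) (t : ℝ) : Plane :=
  AffineMap.lineMap (v j) (v (finRotate n j)) t

/-- The `j`-th edge of the closed polygon with vertices `v`. -/
def edgeSet {n : ℕ} (v : Fin n → Plane) (j : Fin n) : Set Plane :=
  segment ℝ (v j) (v (finRotate n j))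

/-- Length of the `j`-th edge. -/
def edgeLength {n : ℕ} (v : Fin n → Plane) (j : Fin n) : ℝ := dist (v j) (v (finRotate n j))

/-- The unit normal of the `j`-th edge which lies to the right when the edge is run through from
its first to its last vertex: the edge vector turned by a quarter clockwise and normalized. -/
def edgeNormal {n : ℕ} (v : Fin n → Plane) (j : Fin n) : Plane :=
  (edgeLength v j)⁻¹ •
    !₂[v (finRotate n j) 1 - v j 1, -(v (finRotate n j) 0 - v j 0)]

/-- A polygonal cell: a compact set with nonempty interior whose boundary is a simple closed
polygon, the vertices being listed such that the right normals point outward (that is,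
counterclockwise). Consecutive edges may lie on one line. -/
structure PolygonalCell where
  /-- number of edges -/
  n : ℕ
  three_le : 3 ≤ n
  vertex : Fin n → Plane
  /-- the polygon does not intersect itself -/
  simple : ∀ i j : Fin n, ∀ s ∈ Set.Ico (0 : ℝ) 1, ∀ t ∈ Set.Ico (0 : ℝ) 1,
    edgePoint vertex i s = edgePoint vertex j t → i = j ∧ s = t
  /-- the closed region occupied by the cell -/
  region : Set Plane
  isCompact_region : IsCompact region
  nonempty_interior : (interior region).Nonempty
  frontier_eq : frontier region = ⋃ j, edgeSet vertex j
  outward : ∀ j : Fin n, ∀ t ∈ Set.Ioo (0 : ℝ) 1,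
    ∀ᶠ ε in 𝓝[>] (0 : ℝ), edgePoint vertex j t + ε • edgeNormal vertex j ∉ region

/-- The `j`-th edge of a cell. -/
def PolygonalCell.edge (K : PolygonalCell) (j : Fin K.n) : Set Plane := edgeSet K.vertex j

/-- The length of the `j`-th edge of a cell. -/
def PolygonalCell.len (K : PolygonalCell) (j : Fin K.n) : ℝ := edgeLength K.vertex j

/-- The outward unit normal on the `j`-th edge of a cell. -/
def PolygonalCell.normal (K : PolygonalCell) (j : Fin K.n) : Plane := edgeNormal K.vertex j

/-- The area of a cell. -/
def PolygonalCell.area (K : PolygonalCell) : ℝ := volume.real K.region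

/-- The circumference of a cell. -/
def PolygonalCell.perimeter (K : PolygonalCell) : ℝ := ∑ j, K.len j

/-- A mesh of polygonal cells, indexed by `ι`. The cells do not overlap, and each edge
of a cell is either an edge of an adjacent cell or part of the boundary of the meshed domain. -/
structure Mesh (ι : Type*) where
  cell : ι → PolygonalCell
  disjoint_interior : ∀ K K' : ι, K ≠ K' →
    Disjoint (interior (cell K).region) (interior (cell K').region)
  /-- the adjacent cell across an edge, with the number which the edge has there;
  `none` on the boundary -/
  adjacent : (K : ι) → Fin (cell K).n → Option (Σ K' : ι, Fin (cell K').n)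
  adjacent_some : ∀ (K : ι) (j : Fin (cell K).n) (K' : ι) (j' : Fin (cell K').n),
    adjacent K j = some ⟨K', j'⟩ → K' ≠ K ∧ (cell K').edge j' = (cell K).edge j
  adjacent_none : ∀ (K : ι) (j : Fin (cell K).n),
    adjacent K j = none → (cell K).edge j ⊆ frontier (⋃ K', (cell K').region)

/-! ### Quadratures -/

/-- The value at `x` of a polynomial in two variables. -/
def polyEval (P : MvPolynomial (Fin 2) ℝ) (x : Plane) : ℝ := MvPolynomial.eval (fun i => x i) P

/-- A `Q`-point quadrature on the edges with positive weights `ω_q` (normalized to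
edges of unit length) and algebraic degree of accuracy at least `2k`. The points on an edge
and their weights are the same for the two cells which share it, up to their numbering. -/
structure EdgeQuadrature {ι : Type*} (M : Mesh ι) (k Q : ℕ) where
  ω : Fin Q → ℝ
  ω_pos : ∀ q, 0 < ω q
  /-- the point `x_K^{(jq)}` -/
  pt : (K : ι) → Fin (M.cell K).n → Fin Q → Plane
  pt_mem : ∀ K j q, pt K j q ∈ (M.cell K).edge j
  exact_edge : ∀ (K : ι) (j : Fin (M.cell K).n) (P : MvPolynomial (Fin 2) ℝ),
    P.totalDegree ≤ 2 * k →
    ∫ t in (0 : ℝ)..1, polyEval P (edgePoint (M.cell K).vertex j t)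
      = ∑ q, ω q * polyEval P (pt K j q)
  shared : ∀ (K : ι) (j : Fin (M.cell K).n) (K' : ι) (j' : Fin (M.cell K').n),
    M.adjacent K j = some ⟨K', j'⟩ →
    ∀ q, ∃ q', pt K j q = pt K' j' q' ∧ ω q = ω q'

/-- The special quadrature on each cell: it has positive weights, is exact for polynomials of
degree at most `k`, and its nodes are all the edge points `x_K^{(jq)}` together with finitely many
(possibly no) other nodes in the cell. -/
structure CellQuadrature {ι : Type*} {M : Mesh ι} {k Q : ℕ} (R : EdgeQuadrature M k Q) where
  /-- the weight of `x_K^{(jq)}` -/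
  w : (K : ι) → Fin (M.cell K).n → Fin Q → ℝ
  w_pos : ∀ K j q, 0 < w K j q
  /-- the number of other nodes -/
  Q' : ι → ℕ
  pt' : (K : ι) → Fin (Q' K) → Plane
  pt'_mem : ∀ K q, pt' K q ∈ (M.cell K).region
  w' : (K : ι) → Fin (Q' K) → ℝ
  w'_pos : ∀ K q, 0 < w' K q
  exact_cell : ∀ (K : ι) (P : MvPolynomial (Fin 2) ℝ), P.totalDegree ≤ k →
    (M.cell K).area⁻¹ * ∫ x in (M.cell K).region, polyEval P x
      = (∑ j, ∑ q, w K j q * polyEval P (R.pt K j q)) + ∑ q, w' K q * polyEval P (pt' K q)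

/-- The set `𝕊_K` of all nodes of the special quadrature. -/
def CellQuadrature.nodes {ι : Type*} {M : Mesh ι} {k Q : ℕ} {R : EdgeQuadrature M k Q}
    (S : CellQuadrature R) (K : ι) : Set Plane :=
  Set.range (S.pt' K) ∪ {x | ∃ j q, x = R.pt K j q}

/-! ### The scheme -/

/-- `f` is a polynomial function of degree at most `k`. -/
def IsPoly (k : ℕ) (f : Plane → ℝ) : Prop :=
  ∃ P : MvPolynomial (Fin 2) ℝ, P.totalDegree ≤ k ∧ ∀ x, f x = polyEval P x

/-- All eight components of `u` are polynomials of degree at most `k`. -/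
def IsPolyState (k : ℕ) (u : Plane → State) : Prop :=
  IsPoly k (fun x => dens (u x)) ∧ (∀ i, IsPoly k (fun x => mom (u x) i)) ∧
    (∀ i, IsPoly k (fun x => mag (u x) i)) ∧ IsPoly k (fun x => ener (u x))

/-- The average of `u` over a cell. -/
def cellAverage (K : PolygonalCell) (u : Plane → State) : State :=
  K.area⁻¹ • ∫ x in K.region, u x

/-- The data of the scheme at one time level: the limited polynomial vectors on the cells,
and the exterior states prescribed at the quadrature points of the boundary edges (their values
on other edges are not used). -/
structure GridData {ι : Type*} (M : Mesh ι) (Q : ℕ) where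
  U : ι → Plane → State
  bdry : (K : ι) → Fin (M.cell K).n → Fin Q → State

/-- The interior limit `U_{jq}^{int(K)}`. -/
def GridData.int {ι : Type*} {M : Mesh ι} {k Q : ℕ} (D : GridData M Q)
    (R : EdgeQuadrature M k Q) (K : ι) (j : Fin (M.cell K).n) (q : Fin Q) : State :=
  D.U K (R.pt K j q)

/-- The exterior limit `U_{jq}^{ext(K)}`: the value of the polynomial vector of the adjacent cell
or, on the boundary, the prescribed state. -/
def GridData.ext {ι : Type*} {M : Mesh ι} {k Q : ℕ} (D : GridData M Q)
    (R : EdgeQuadrature M k Q) (K : ι) (j : Fin (M.cell K).n) (q : Fin Q) : State :=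
  match M.adjacent K j with
  | some K' => D.U K'.1 (R.pt K j q)
  | none => D.bdry K j q

/-- `σ_{jq}^{K,+}`. -/
def sigmaPlus {ι : Type*} {M : Mesh ι} {k Q : ℕ} (σ : WaveSpeeds) (D : GridData M Q)
    (R : EdgeQuadrature M k Q) (K : ι) (j : Fin (M.cell K).n) (q : Fin Q) : ℝ :=
  σ.plus (D.int R K j q) (D.ext R K j q) ((M.cell K).normal j)

/-- `σ_{jq}^{K,-}`. -/
def sigmaMinus {ι : Type*} {M : Mesh ι} {k Q : ℕ} (σ : WaveSpeeds) (D : GridData M Q)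
    (R : EdgeQuadrature M k Q) (K : ι) (j : Fin (M.cell K).n) (q : Fin Q) : ℝ :=
  σ.minus (D.int R K j q) (D.ext R K j q) ((M.cell K).normal j)

/-- `\hat α_{jq}^{int(K)}`. -/
def alphaHat {ι : Type*} {M : Mesh ι} {k Q : ℕ} (p : ℝ → ℝ → ℝ) (D : GridData M Q)
    (R : EdgeQuadrature M k Q) (K : ι) (j : Fin (M.cell K).n) (q : Fin Q) : ℝ :=
  waveC p (D.int R K j q) ((M.cell K).normal j)
    + 2 / (M.cell K).perimeter * ∑ i, (M.cell K).len i *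
        (‖mag (D.int R K j q) - mag (D.int R K i q)‖
          / (√(dens (D.int R K j q)) + √(dens (D.int R K i q))))
    + max (pair ((M.cell K).normal j) (vel (D.int R K j q)))
        (1 / (M.cell K).perimeter * ∑ i, (M.cell K).len i *
          pair ((M.cell K).normal j - (M.cell K).normal i)
            (roeVel (D.int R K j q) (D.int R K i q)))

/-- The new cell average of the conservative scheme with time step `Δt`. -/
def newAverage {ι : Type*} {M : Mesh ι} {k Q : ℕ} (p : ℝ → ℝ → ℝ) (σ : WaveSpeeds)
    (D : GridData M Q) (R : EdgeQuadrature M k Q) (Δt : ℝ) (K : ι) : State :=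
  cellAverage (M.cell K) (D.U K) - (Δt / (M.cell K).area) • ∑ j, ∑ q,
    ((M.cell K).len j * R.ω q) •
      hllFlux p σ (D.int R K j q) (D.ext R K j q) ((M.cell K).normal j)

/-- The discrete divergence of the magnetic field. -/
def discreteDiv {ι : Type*} {M : Mesh ι} {k Q : ℕ} (σ : WaveSpeeds)
    (D : GridData M Q) (R : EdgeQuadrature M k Q) (K : ι) : ℝ :=
  1 / (M.cell K).area * ∑ j, ∑ q, (M.cell K).len j * R.ω q *
    pair ((M.cell K).normal j)
      ((sigmaPlus σ D R K j q - sigmaMinus σ D R K j q)⁻¹ •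
        (sigmaPlus σ D R K j q • mag (D.int R K j q)
          - sigmaMinus σ D R K j q • mag (D.ext R K j q)))

end MHD

end

/-!
Admissibility is tested with linear functionals. For a velocity `v` and a magnetic field `b` let
`φ(U) = U · (|v|²/2, -v, -b, 1)`. If `ρ > 0`, then
`φ(U) + |b|²/2 = ρ|vel U - v|²/2 + |mag U - b|²/2 + ℰ(U)` (`testFunctional_add`), which is positive
on admissible states and equals `ℰ(U)` for `v = vel U`, `b = mag U`. It is therefore enough to bound
`φ` at the new cell average from below for all `v` and `b`, and since `φ` is linear, this reduces to
bounds for `φ` of the fluxes.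

The functional of the flux of one state consists of a convection term, a divergence term
`(v · b) ⟨ξ, B⟩` and a quadratic form whose largest eigenvalue is the fast speed `𝒞`
(`testFunctional_normalFlux`, `fast_wave_inequality`). The convection of the magnetic part is by
the arbitrary velocity `v`, so it cannot be bounded for one state alone. For two states it enters
as `⟨ξ, v⟩` times a difference of the magnetic parts, and `v` may be replaced by the `√ρ`-weighted
average of their velocities at the price of the jump term `|B - B'| / (√ρ + √ρ')`
(`pair_mul_sub_le`). This gives the two-state inequality with `α_r`, `α_l`
(`testFunctional_flux_difference_le`). On a cell the outward normals weighted by the edge lengths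
sum up to zero, so that only such differences occur there as well; this gives the inequality with
`\hat α` (`sum_testFunctional_normalFlux_le`).

The HLL flux is the flux of the interior state plus `σ⁻` times the difference of an intermediate
state and the interior state; the two-state inequality says that the intermediate state behaves
like an admissible one (`hllFlux_functional_le`). The exact cell quadrature writes the old average
as a convex combination of nodal values, and the time step restriction keeps the coefficients of
the edge values positive (`newAverage_functional_pos`). The density is treated in the same way,
with the functional `U ↦ ρ`.
-/

noncomputable section

namespace MHD

/-! ### Planar directions -/

/-- The planar direction `ξ` as a vector of `ℝ³` with third component zero. -/
def planeToSpace (ξ : Plane) : Vec3 := !₂[ξ 0, ξ 1, 0]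

theorem pair_eq_inner (ξ : Plane) (w : Vec3) : pair ξ w = inner ℝ (planeToSpace ξ) w := by
  simp [pair, planeToSpace, PiLp.inner_apply, Fin.sum_univ_three, mul_comm]

theorem norm_planeToSpace (ξ : Plane) : ‖planeToSpace ξ‖ = ‖ξ‖ := by
  simp [planeToSpace, EuclideanSpace.norm_eq, Fin.sum_univ_three]

theorem pair_add (ξ : Plane) (v w : Vec3) : pair ξ (v + w) = pair ξ v + pair ξ w := by
  simp [pair_eq_inner, inner_add_right]

theorem pair_sub (ξ : Plane) (v w : Vec3) : pair ξ (v - w) = pair ξ v - pair ξ w := by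
  simp [pair_eq_inner, inner_sub_right]

theorem pair_smul (ξ : Plane) (c : ℝ) (w : Vec3) : pair ξ (c • w) = c * pair ξ w := by
  simp [pair_eq_inner, inner_smul_right]

theorem pair_sub_left (ξ ζ : Plane) (w : Vec3) : pair (ξ - ζ) w = pair ξ w - pair ζ w := by
  simp [pair, sub_mul]

theorem sum_mul_pair {κ : Type*} [Fintype κ] (s : κ → ℝ) (ξ : κ → Plane) (w : Vec3) :
    ∑ j, s j * pair (ξ j) w = pair (∑ j, s j • ξ j) w := by
  simp only [pair, Fin.sum_univ_two]
  simp [Finset.sum_mul, mul_add, Finset.sum_add_distrib, mul_assoc]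

theorem pair_zero_left (w : Vec3) : pair 0 w = 0 := by simp [pair]

theorem abs_pair_le {ξ : Plane} (hξ : ‖ξ‖ = 1) (w : Vec3) : |pair ξ w| ≤ ‖w‖ := by
  rw [pair_eq_inner]
  simpa [norm_planeToSpace, hξ] using abs_real_inner_le_norm (planeToSpace ξ) w

/-! ### The fast-wave inequality -/

theorem waveC_nonneg (p : ℝ → ℝ → ℝ) (U : State) (ξ : Plane) : 0 ≤ waveC p U ξ := by
  unfold waveC; positivity

/-- `c` is the larger eigenvalue of the symmetric matrix with rows `(a², aβ)` and `(aβ, β² + d²)`,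
where `β² = q`. The hypotheses express that `c` is a root of the characteristic polynomial and lies
above the diagonal; `g` plays the role of `⟨β, η⟩` for a vector `η` with `‖η‖² = h`. -/
theorem quadratic_form_le {a q d c z g h y : ℝ} (ha : 0 < a)
    (hroot : (c - a ^ 2) * (c - (q + d ^ 2)) = a ^ 2 * q) (hca : a ^ 2 ≤ c)
    (hcb : q + d ^ 2 ≤ c) (hg : g ^ 2 ≤ q * h) (hh : 0 ≤ h) (hy : h ≤ y) :
    (a * z + g) ^ 2 + d ^ 2 * h ≤ c * (y + z ^ 2) := by
  have hc : 0 ≤ c := (sq_nonneg a).trans hca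
  have hcy := mul_le_mul_of_nonneg_left hy hc
  suffices 0 ≤ (c - a ^ 2) * z ^ 2 - 2 * a * g * z + (c - (q + d ^ 2)) * h + (q * h - g ^ 2) by
    nlinarith
  rcases hca.eq_or_lt with h0 | h0
  · have hq : q = 0 := by
      have : a ^ 2 * q = 0 := by rw [← hroot, ← h0]; ring
      simpa [ha.ne'] using this
    have hg0 : g = 0 := by
      have : g ^ 2 ≤ 0 := by simpa [hq] using hg
      exact pow_eq_zero_iff two_ne_zero |>.1 (le_antisymm this (sq_nonneg g))
    have := mul_nonneg (sub_nonneg.2 hcb) hh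
    rw [hg0, ← h0]
    rw [← h0, hq] at this
    simp [hq]
    simpa using this
  · have h1 : 0 < c - a ^ 2 := sub_pos.2 h0
    -- completing the square in `z`
    have h2 : 0 ≤ (c - a ^ 2) *
        ((c - a ^ 2) * z ^ 2 - 2 * a * g * z + (c - (q + d ^ 2)) * h) := by
      have : (c - a ^ 2) * ((c - a ^ 2) * z ^ 2 - 2 * a * g * z + (c - (q + d ^ 2)) * h)
          = ((c - a ^ 2) * z - a * g) ^ 2 + a ^ 2 * (q * h - g ^ 2) := by
        linear_combination h * hroot
      rw [this]
      have := sub_nonneg.2 hg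
      positivity
    have := nonneg_of_mul_nonneg_right h2 h1
    linarith

/-- The bilinear form of the linearized magnetohydrodynamic flux in symmetrizing variables is
bounded by the fast speed `C`. -/
theorem two_mul_symmetrized_flux_le {E : Type*} [NormedAddCommGroup E] [InnerProductSpace ℝ E]
    {n b x y : E} {a z C : ℝ} (hn : ‖n‖ = 1) (ha : 0 < a) (hC : 0 < C)
    (hroot : (C ^ 2 - a ^ 2) * (C ^ 2 - ‖b‖ ^ 2) = a ^ 2 * (‖b‖ ^ 2 - inner ℝ n b ^ 2))
    (hca : a ^ 2 ≤ C ^ 2) (hcb : ‖b‖ ^ 2 ≤ C ^ 2) :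
    2 * (a * z * inner ℝ n x + inner ℝ n x * inner ℝ b y - inner ℝ n b * inner ℝ x y)
      ≤ C * (‖x‖ ^ 2 + ‖y‖ ^ 2 + z ^ 2) := by
  set d : ℝ := inner ℝ n b with hd
  set yn : ℝ := inner ℝ n y with hyn
  have hnn : inner ℝ n n = (1 : ℝ) := by rw [real_inner_self_eq_norm_sq, hn]; norm_num
  set m : E := (a * z + inner ℝ b y) • n - d • y with hm
  have hβ : ‖b - d • n‖ ^ 2 = ‖b‖ ^ 2 - d ^ 2 := by
    rw [norm_sub_sq_real, inner_smul_right, real_inner_comm, ← hd, norm_smul, hn,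
      Real.norm_eq_abs, mul_one, sq_abs]
    ring
  have hη : ‖y - yn • n‖ ^ 2 = ‖y‖ ^ 2 - yn ^ 2 := by
    rw [norm_sub_sq_real, inner_smul_right, real_inner_comm, ← hyn, norm_smul, hn,
      Real.norm_eq_abs, mul_one, sq_abs]
    ring
  have hβη : inner ℝ (b - d • n) (y - yn • n) = inner ℝ b y - d * yn := by
    simp only [inner_sub_left, inner_sub_right, inner_smul_left, inner_smul_right, hnn,
      real_inner_comm n b, ← hd, ← hyn]
    simp
  have hcs := real_inner_mul_inner_self_le (b - d • n) (y - yn • n)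
  rw [real_inner_self_eq_norm_sq, real_inner_self_eq_norm_sq, hβη, hβ, hη] at hcs
  have hmm : ‖m‖ ^ 2 = (a * z + (inner ℝ b y - d * yn)) ^ 2 + d ^ 2 * (‖y‖ ^ 2 - yn ^ 2) := by
    rw [hm, norm_sub_sq_real, inner_smul_left, inner_smul_right, ← hyn, norm_smul, norm_smul, hn]
    simp only [Real.norm_eq_abs, mul_pow, sq_abs, conj_trivial]
    ring
  have hM : ‖m‖ ^ 2 ≤ C ^ 2 * (‖y‖ ^ 2 + z ^ 2) := by
    rw [hmm]
    refine quadratic_form_le (q := ‖b‖ ^ 2 - d ^ 2) ha ?_ hca ?_ ?_ ?_ ?_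
    · rw [← hroot]; ring
    · linarith
    · linarith
    · rw [← hη]; positivity
    · linarith [sq_nonneg yn]
  have hxm : a * z * inner ℝ n x + inner ℝ n x * inner ℝ b y - d * inner ℝ x y = inner ℝ x m := by
    rw [hm, inner_sub_right, inner_smul_right, inner_smul_right, real_inner_comm n x]
    ring
  rw [hxm]
  have h1 := real_inner_le_norm x m
  have h2 : ‖m‖ ≤ C * √(‖y‖ ^ 2 + z ^ 2) := by
    apply le_of_sq_le_sq _ (by positivity)
    rw [mul_pow, Real.sq_sqrt (by positivity)]
    exact hM
  have h3 := mul_le_mul_of_nonneg_left h2 (norm_nonneg x)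
  have h4 : √(‖y‖ ^ 2 + z ^ 2) ^ 2 = ‖y‖ ^ 2 + z ^ 2 := Real.sq_sqrt (by positivity)
  nlinarith [mul_nonneg hC.le (sq_nonneg (‖x‖ - √(‖y‖ ^ 2 + z ^ 2)))]

/-- `𝒞²` is the larger root of `c² - (𝒞_s² + |B|² / ρ) c + 𝒞_s² ⟨ξ, B⟩² / ρ`. -/
theorem waveC_sq {p : ℝ → ℝ → ℝ} {U : State} {ξ : Plane} (hρ : 0 < dens U) (hξ : ‖ξ‖ = 1) :
    (waveC p U ξ ^ 2 - soundC p U ^ 2) * (waveC p U ξ ^ 2 - ‖mag U‖ ^ 2 / dens U)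
        = soundC p U ^ 2 * (‖mag U‖ ^ 2 / dens U - pair ξ (mag U) ^ 2 / dens U) ∧
      soundC p U ^ 2 ≤ waveC p U ξ ^ 2 ∧ ‖mag U‖ ^ 2 / dens U ≤ waveC p U ξ ^ 2 := by
  set a := soundC p U ^ 2 with ha
  set b := ‖mag U‖ ^ 2 / dens U with hb
  set d := pair ξ (mag U) ^ 2 / dens U with hd
  have ha0 : 0 ≤ a := by positivity
  have hdb : d ≤ b := by
    rw [hd, hb]
    gcongr ?_ / _
    exact sq_le_sq.2 (by simpa using abs_pair_le hξ (mag U))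
  have hb0 : 0 ≤ b := by positivity
  have hC : waveC p U ξ ^ 2 = (a + b + √((a + b) ^ 2 - 4 * (a * d))) / 2 := by
    unfold waveC
    rw [mul_pow, Real.sq_sqrt (by positivity), div_pow, Real.sq_sqrt zero_le_two, mul_div_assoc]
    ring
  have hge : (a - b) ^ 2 ≤ (a + b) ^ 2 - 4 * (a * d) := by nlinarith
  have hab : |a - b| ≤ √((a + b) ^ 2 - 4 * (a * d)) := Real.abs_le_sqrt hge
  have hsq := Real.sq_sqrt ((sq_nonneg _).trans hge)
  set r := √((a + b) ^ 2 - 4 * (a * d))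
  rw [hC]
  refine ⟨by nlinarith, ?_, ?_⟩ <;> linarith [abs_le.1 hab]

theorem pressure_pos {p : ℝ → ℝ → ℝ} (hp : IsEOS p) {U : State} (hU : U ∈ admissible) :
    0 < pressure p U :=
  (hp _ _ hU.1).1 (div_pos hU.2 hU.1)

theorem fast_wave_inequality {p : ℝ → ℝ → ℝ} (hp : IsEOS p) {U : State} (hU : U ∈ admissible)
    {ξ : Plane} (hξ : ‖ξ‖ = 1) (w y : Vec3) :
    pressure p U * pair ξ w + pair ξ w * inner ℝ (mag U) y - pair ξ (mag U) * inner ℝ w y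
      ≤ waveC p U ξ * (dens U * ‖w‖ ^ 2 / 2 + ‖y‖ ^ 2 / 2 + internalEnergy U) := by
  have hρ := hU.1
  have hε := hU.2
  have he : 0 < specificEnergy U := div_pos hε hρ
  set r := √(dens U) with hr
  have hr0 : 0 < r := Real.sqrt_pos.2 hρ
  have hr2 : r ^ 2 = dens U := Real.sq_sqrt hρ.le
  set t := √(2 * specificEnergy U) with ht
  have ht0 : 0 < t := Real.sqrt_pos.2 (by positivity)
  have ht2 : t ^ 2 = 2 * specificEnergy U := Real.sq_sqrt (by positivity)
  have ha : 0 < soundC p U := by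
    have := pressure_pos hp hU
    unfold soundC
    rw [← ht]
    positivity
  obtain ⟨hroot, hca, hcb⟩ := waveC_sq (p := p) hρ hξ
  have hC : 0 < waveC p U ξ := by
    refine (waveC_nonneg p U ξ).lt_of_ne' fun h => ?_
    rw [h] at hca
    nlinarith
  -- the symmetrizing variables are `√ρ w`, `B / √ρ` and `√(2ρe)`
  have hb2 : ‖r⁻¹ • mag U‖ ^ 2 = ‖mag U‖ ^ 2 / dens U := by
    rw [norm_smul, mul_pow, Real.norm_eq_abs, sq_abs, inv_pow, hr2]
    field_simp
  have hbn : (inner ℝ (planeToSpace ξ) (r⁻¹ • mag U) : ℝ) = r⁻¹ * pair ξ (mag U) := by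
    rw [inner_smul_right, pair_eq_inner]
  have key := two_mul_symmetrized_flux_le (n := planeToSpace ξ) (b := r⁻¹ • mag U) (x := r • w)
    (y := y) (z := r * t) (a := soundC p U) (C := waveC p U ξ)
    (by rw [norm_planeToSpace, hξ]) ha hC
    (by rw [hb2, hbn, mul_pow, inv_pow, hr2, hroot]; ring) hca (by rw [hb2]; exact hcb)
  rw [hbn] at key
  simp only [inner_smul_left, inner_smul_right, ← pair_eq_inner, conj_trivial, norm_smul,
    Real.norm_eq_abs, mul_pow, sq_abs, hr2, ht2] at key
  have h1 : soundC p U * (r * t) * (r * pair ξ w) = pressure p U * pair ξ w := by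
    have : soundC p U * (r * t) * (r * pair ξ w) = soundC p U * t * r ^ 2 * pair ξ w := by ring
    rw [this, hr2, soundC, ← ht]
    field_simp
  have h2 : r * pair ξ w * (r⁻¹ * inner ℝ (mag U) y) = pair ξ w * inner ℝ (mag U) y := by
    field_simp
  have h3 : r⁻¹ * pair ξ (mag U) * (r * inner ℝ w y) = pair ξ (mag U) * inner ℝ w y := by
    field_simp
  have h4 : dens U * (2 * specificEnergy U) = 2 * internalEnergy U := by
    unfold specificEnergy
    field_simp
  rw [h1, h2, h3, h4] at key
  linarith

/-! ### The linear functionals that characterize admissible states -/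

/-- The linear functional `U ↦ U · (|v|² / 2, -v, -b, 1)`. -/
def testFunctional (v b : Vec3) : State →ₗ[ℝ] ℝ where
  toFun U := dens U * (‖v‖ ^ 2 / 2) - inner ℝ v (mom U) - inner ℝ b (mag U) + ener U
  map_add' U V := by
    simp only [dens, mom, mag, ener, Prod.fst_add, Prod.snd_add, inner_add_right]
    ring
  map_smul' c U := by
    simp only [dens, mom, mag, ener, Prod.smul_fst, Prod.smul_snd, inner_smul_right, smul_eq_mul,
      RingHom.id_apply]
    ring

theorem testFunctional_apply (v b : Vec3) (U : State) : testFunctional v b U =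
    dens U * (‖v‖ ^ 2 / 2) - inner ℝ v (mom U) - inner ℝ b (mag U) + ener U := rfl

/-- The energy of the deviation of `U` from a state of velocity `v` and magnetic field `b`. -/
def relativeEnergy (v b : Vec3) (U : State) : ℝ :=
  dens U * ‖vel U - v‖ ^ 2 / 2 + ‖mag U - b‖ ^ 2 / 2 + internalEnergy U

theorem dens_smul_vel {U : State} (hU : 0 < dens U) : dens U • vel U = mom U := by
  rw [vel, smul_inv_smul₀ hU.ne']

theorem norm_mom_sq_div {U : State} (hU : 0 < dens U) :
    ‖mom U‖ ^ 2 / dens U = dens U * ‖vel U‖ ^ 2 := by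
  rw [← dens_smul_vel hU, norm_smul, mul_pow, Real.norm_eq_abs, sq_abs]
  field_simp

theorem testFunctional_add {U : State} (hU : 0 < dens U) (v b : Vec3) :
    testFunctional v b U + ‖b‖ ^ 2 / 2 = relativeEnergy v b U := by
  rw [testFunctional_apply, relativeEnergy, internalEnergy, norm_mom_sq_div hU,
    ← dens_smul_vel hU, norm_sub_sq_real, norm_sub_sq_real, inner_smul_right,
    real_inner_comm v, real_inner_comm b]
  ring

theorem relativeEnergy_pos {U : State} (hU : U ∈ admissible) (v b : Vec3) :
    0 < relativeEnergy v b U := by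
  have h1 := hU.1
  have h2 := hU.2
  unfold relativeEnergy
  positivity

theorem dens_normalFlux {p : ℝ → ℝ → ℝ} {ξ : Plane} {U : State} :
    dens (normalFlux p ξ U) = dens U * pair ξ (vel U) := by
  simp [normalFlux, pair, flux, dens, Fin.sum_univ_two]
  ring

theorem mom_normalFlux {p : ℝ → ℝ → ℝ} {ξ : Plane} {U : State} :
    mom (normalFlux p ξ U) = (dens U * pair ξ (vel U)) • vel U - pair ξ (mag U) • mag U
      + totalPressure p U • planeToSpace ξ := by
  ext i
  fin_cases i <;>
    simp [normalFlux, pair, flux, mom, Fin.sum_univ_two, planeToSpace] <;> ring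

theorem mag_normalFlux {p : ℝ → ℝ → ℝ} {ξ : Plane} {U : State} :
    mag (normalFlux p ξ U) = pair ξ (vel U) • mag U - pair ξ (mag U) • vel U := by
  ext i
  simp [normalFlux, pair, flux, mag, Fin.sum_univ_two]
  ring

theorem ener_normalFlux {p : ℝ → ℝ → ℝ} {ξ : Plane} {U : State} :
    ener (normalFlux p ξ U) = pair ξ (vel U) * (ener U + totalPressure p U)
      - pair ξ (mag U) * inner ℝ (vel U) (mag U) := by
  simp [normalFlux, pair, flux, ener, Fin.sum_univ_two]
  ring

/-- Apart from the divergence term and a term independent of `U`, the functional of the flux is a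
convection term plus the terms which the fast-wave inequality controls. -/
theorem testFunctional_normalFlux {p : ℝ → ℝ → ℝ} {ξ : Plane} {U : State} (hU : 0 < dens U)
    (v b : Vec3) :
    testFunctional v b (normalFlux p ξ U) =
      pair ξ (vel U) * (dens U * ‖vel U - v‖ ^ 2 / 2 + internalEnergy U)
        + pair ξ v * (‖mag U - b‖ ^ 2 / 2)
        + (pressure p U * pair ξ (vel U - v) + pair ξ (vel U - v) * inner ℝ (mag U) (mag U - b)
          - pair ξ (mag U) * inner ℝ (vel U - v) (mag U - b))
        + inner ℝ v b * pair ξ (mag U) - pair ξ v * (‖b‖ ^ 2 / 2) := by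
  rw [testFunctional_apply, dens_normalFlux, mom_normalFlux, mag_normalFlux, ener_normalFlux,
    internalEnergy, norm_mom_sq_div hU]
  simp only [inner_add_right, inner_sub_right, inner_sub_left, inner_smul_right, pair_sub,
    norm_sub_sq_real, totalPressure, real_inner_self_eq_norm_sq]
  rw [real_inner_comm (planeToSpace ξ) v, ← pair_eq_inner, real_inner_comm v (vel U),
    real_inner_comm b (mag U), real_inner_comm b (vel U)]
  ring

theorem testFunctional_normalFlux_le {p : ℝ → ℝ → ℝ} (hp : IsEOS p) {ξ : Plane} (hξ : ‖ξ‖ = 1)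
    {U : State} (hU : U ∈ admissible) (v b : Vec3) :
    testFunctional v b (normalFlux p ξ U) ≤
      pair ξ (vel U) * (dens U * ‖vel U - v‖ ^ 2 / 2 + internalEnergy U)
        + pair ξ v * (‖mag U - b‖ ^ 2 / 2) + waveC p U ξ * relativeEnergy v b U
        + inner ℝ v b * pair ξ (mag U) - pair ξ v * (‖b‖ ^ 2 / 2) := by
  rw [testFunctional_normalFlux hU.1]
  have := fast_wave_inequality hp hU hξ (vel U - v) (mag U - b)
  unfold relativeEnergy
  linarith

theorem pair_neg_left (ξ : Plane) (w : Vec3) : pair (-ξ) w = -pair ξ w := by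
  simp [pair]

theorem waveC_neg (p : ℝ → ℝ → ℝ) (U : State) (ξ : Plane) : waveC p U (-ξ) = waveC p U ξ := by
  simp [waveC, pair_neg_left]

theorem neg_testFunctional_normalFlux_le {p : ℝ → ℝ → ℝ} (hp : IsEOS p) {ξ : Plane}
    (hξ : ‖ξ‖ = 1) {U : State} (hU : U ∈ admissible) (v b : Vec3) :
    -testFunctional v b (normalFlux p ξ U) ≤
      -pair ξ (vel U) * (dens U * ‖vel U - v‖ ^ 2 / 2 + internalEnergy U)
        - pair ξ v * (‖mag U - b‖ ^ 2 / 2) + waveC p U ξ * relativeEnergy v b U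
        - inner ℝ v b * pair ξ (mag U) + pair ξ v * (‖b‖ ^ 2 / 2) := by
  have h := testFunctional_normalFlux_le hp (ξ := -ξ) (by rwa [norm_neg]) hU v b
  have hF : normalFlux p (-ξ) U = -normalFlux p ξ U := by
    simp [normalFlux, Fin.sum_univ_two, add_comm]
  rw [hF, map_neg, waveC_neg] at h
  simp only [pair_neg_left] at h
  linarith

/-! ### Interaction of two states -/

/-- The coefficient of the jump of the magnetic field in `α_r`, `α_l` and `\hat α`. -/
def jumpSpeed (U V : State) : ℝ := ‖mag U - mag V‖ / (√(dens U) + √(dens V))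

theorem jumpSpeed_comm (U V : State) : jumpSpeed U V = jumpSpeed V U := by
  rw [jumpSpeed, jumpSpeed, norm_sub_rev, add_comm]

theorem roeVel_comm (U V : State) : roeVel U V = roeVel V U := by
  rw [roeVel, roeVel, add_comm, add_comm (√(dens U) • vel U)]

/-- Replacing the arbitrary velocity `v` by the averaged velocity of the two states changes the
convection of the magnetic energy difference by an amount which the relative energies control.
The weights `√ρ` of the average are those which make this possible. -/
theorem pair_mul_sub_le {ξ : Plane} (hξ : ‖ξ‖ = 1) {U V : State} (hU : U ∈ admissible)
    (hV : V ∈ admissible) (v b : Vec3) :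
    pair ξ v * (‖mag U - b‖ ^ 2 / 2 - ‖mag V - b‖ ^ 2 / 2) ≤
      pair ξ (roeVel U V) * (‖mag U - b‖ ^ 2 / 2 - ‖mag V - b‖ ^ 2 / 2)
        + jumpSpeed U V * (relativeEnergy v b U + relativeEnergy v b V) := by
  have hr : 0 < √(dens U) := Real.sqrt_pos.2 hU.1
  have hs : 0 < √(dens V) := Real.sqrt_pos.2 hV.1
  have hr2 : √(dens U) ^ 2 = dens U := Real.sq_sqrt hU.1.le
  have hs2 : √(dens V) ^ 2 = dens V := Real.sq_sqrt hV.1.le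
  have hεU := hU.2
  have hεV := hV.2
  unfold relativeEnergy jumpSpeed
  rw [← hr2, ← hs2]
  set r := √(dens U)
  set s := √(dens V)
  rw [Real.sqrt_sq hr.le, Real.sqrt_sq hs.le]
  have hroe : pair ξ v - pair ξ (roeVel U V)
      = -(r + s)⁻¹ * (r * pair ξ (vel U - v) + s * pair ξ (vel V - v)) := by
    simp only [roeVel, pair_smul, pair_add, pair_sub]
    change _ - (r + s)⁻¹ * (r * _ + s * _) = _
    field_simp
    ring
  have hmag : ‖mag U - b‖ ^ 2 - ‖mag V - b‖ ^ 2
      = inner ℝ (mag U - mag V) ((mag U - b) + (mag V - b)) := by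
    have : mag U - mag V = (mag U - b) - (mag V - b) := by abel
    rw [this, inner_sub_left, inner_add_right, inner_add_right, real_inner_self_eq_norm_sq,
      real_inner_self_eq_norm_sq, real_inner_comm (mag U - b)]
    ring
  have h1 : |‖mag U - b‖ ^ 2 - ‖mag V - b‖ ^ 2|
      ≤ ‖mag U - mag V‖ * (‖mag U - b‖ + ‖mag V - b‖) := by
    rw [hmag]
    exact (abs_real_inner_le_norm _ _).trans (by gcongr; exact norm_add_le _ _)
  have h2 : |r * pair ξ (vel U - v) + s * pair ξ (vel V - v)|
      ≤ r * ‖vel U - v‖ + s * ‖vel V - v‖ := by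
    refine (abs_add_le _ _).trans ?_
    rw [abs_mul, abs_mul, abs_of_pos hr, abs_of_pos hs]
    gcongr <;> exact abs_pair_le hξ _
  have h3 : (pair ξ v - pair ξ (roeVel U V)) * (‖mag U - b‖ ^ 2 - ‖mag V - b‖ ^ 2) ≤
      (r + s)⁻¹ * ((r * ‖vel U - v‖ + s * ‖vel V - v‖) *
        (‖mag U - mag V‖ * (‖mag U - b‖ + ‖mag V - b‖))) := by
    rw [hroe, neg_mul, neg_mul, mul_assoc, ← mul_neg]
    gcongr
    refine (neg_le_abs _).trans ?_
    rw [abs_mul]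
    gcongr
  have h4 : (r * ‖vel U - v‖ + s * ‖vel V - v‖) * (‖mag U - b‖ + ‖mag V - b‖) ≤
      2 * ((r ^ 2 * ‖vel U - v‖ ^ 2 / 2 + ‖mag U - b‖ ^ 2 / 2 + internalEnergy U)
        + (s ^ 2 * ‖vel V - v‖ ^ 2 / 2 + ‖mag V - b‖ ^ 2 / 2 + internalEnergy V)) := by
    nlinarith [sq_nonneg (r * ‖vel U - v‖ - ‖mag U - b‖), sq_nonneg (r * ‖vel U - v‖ - ‖mag V - b‖),
      sq_nonneg (s * ‖vel V - v‖ - ‖mag U - b‖), sq_nonneg (s * ‖vel V - v‖ - ‖mag V - b‖)]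
  have h5 := mul_le_mul_of_nonneg_left h4
    (show 0 ≤ ‖mag U - mag V‖ / (r + s) by positivity)
  have h6 : (r + s)⁻¹ * ((r * ‖vel U - v‖ + s * ‖vel V - v‖) *
        (‖mag U - mag V‖ * (‖mag U - b‖ + ‖mag V - b‖)))
      = ‖mag U - mag V‖ / (r + s) *
        ((r * ‖vel U - v‖ + s * ‖vel V - v‖) * (‖mag U - b‖ + ‖mag V - b‖)) := by
    rw [div_eq_mul_inv]; ring
  linarith

theorem convection_le_max {U : State} (hU : U ∈ admissible) (v b : Vec3) (c d : ℝ) :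
    c * (dens U * ‖vel U - v‖ ^ 2 / 2 + internalEnergy U) + d * (‖mag U - b‖ ^ 2 / 2)
      ≤ max c d * relativeEnergy v b U := by
  have h1 := hU.1
  have h2 := hU.2
  have h3 : 0 ≤ dens U * ‖vel U - v‖ ^ 2 / 2 + internalEnergy U := by positivity
  have h4 : 0 ≤ ‖mag U - b‖ ^ 2 / 2 := by positivity
  have h5 := mul_le_mul_of_nonneg_right (le_max_left c d) h3
  have h6 := mul_le_mul_of_nonneg_right (le_max_right c d) h4
  unfold relativeEnergy
  linarith

theorem testFunctional_flux_difference_le {p : ℝ → ℝ → ℝ} (hp : IsEOS p) {ξ : Plane}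
    (hξ : ‖ξ‖ = 1) {U V : State} (hU : U ∈ admissible) (hV : V ∈ admissible) (v b : Vec3) :
    testFunctional v b (normalFlux p ξ V) - testFunctional v b (normalFlux p ξ U) ≤
      alphaR p V U ξ * relativeEnergy v b V - alphaL p U V ξ * relativeEnergy v b U
        + inner ℝ v b * (pair ξ (mag V) - pair ξ (mag U)) := by
  have h1 := testFunctional_normalFlux_le hp hξ hV v b
  have h2 := neg_testFunctional_normalFlux_le hp hξ hU v b
  have h3 := pair_mul_sub_le hξ hV hU v b
  have h4 := convection_le_max hV v b (pair ξ (vel V)) (pair ξ (roeVel V U))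
  have h5 := convection_le_max hU v b (-pair ξ (vel U)) (-pair ξ (roeVel V U))
  rw [max_neg_neg, roeVel_comm V U] at h5
  have hR : alphaR p V U ξ = max (pair ξ (vel V)) (pair ξ (roeVel V U)) + waveC p V ξ
    + jumpSpeed V U := rfl
  have hL : alphaL p U V ξ = min (pair ξ (vel U)) (pair ξ (roeVel U V)) - waveC p U ξ
    - jumpSpeed V U := by rw [jumpSpeed_comm]; rfl
  rw [hR, hL]
  rw [roeVel_comm V U] at h3 h4 ⊢
  linarith

/-! ### The closed polygon -/

/-- For weighted unit directions which sum up to zero, the convection of the magnetic energies by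
an arbitrary velocity `v` is a double sum of differences; each difference is estimated by means of
the averaged velocity of the two states. -/
theorem sum_pair_mul_le {κ : Type*} [Fintype κ] {s : κ → ℝ} {ξ : κ → Plane} {U : κ → State}
    (hs : ∀ j, 0 ≤ s j) (hs0 : 0 < ∑ j, s j) (hξ : ∀ j, ‖ξ j‖ = 1) (hsum : ∑ j, s j • ξ j = 0)
    (hU : ∀ j, U j ∈ admissible) (v b : Vec3) :
    ∑ j, s j * (pair (ξ j) v * (‖mag (U j) - b‖ ^ 2 / 2)) ≤
      ∑ j, s j * (1 / (∑ i, s i) * (∑ i, s i * pair (ξ j - ξ i) (roeVel (U j) (U i)))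
          * (‖mag (U j) - b‖ ^ 2 / 2)
        + 2 / (∑ i, s i) * (∑ i, s i * jumpSpeed (U j) (U i)) * relativeEnergy v b (U j)) := by
  set T := ∑ i, s i with hT
  set D : κ → ℝ := fun j => ‖mag (U j) - b‖ ^ 2 / 2 with hD
  set A : κ → ℝ := fun j => relativeEnergy v b (U j) with hA
  have hzero : ∑ j, s j * pair (ξ j) v = 0 := by rw [sum_mul_pair, hsum, pair_zero_left]
  have hL : T * ∑ j, s j * (pair (ξ j) v * D j)
      = ∑ j, ∑ i, s j * s i * (pair (ξ j) v * (D j - D i)) := by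
    have h1 : ∑ j, ∑ i, s j * s i * (pair (ξ j) v * (D j - D i))
        = ∑ j, (T * (s j * (pair (ξ j) v * D j)) - (s j * pair (ξ j) v) * ∑ i, s i * D i) := by
      refine Finset.sum_congr rfl fun j _ => ?_
      rw [hT, Finset.sum_mul, Finset.mul_sum, ← Finset.sum_sub_distrib]
      exact Finset.sum_congr rfl fun i _ => by ring
    rw [h1, Finset.sum_sub_distrib, ← Finset.sum_mul, hzero, zero_mul, sub_zero, Finset.mul_sum]
  have hle : ∑ j, ∑ i, s j * s i * (pair (ξ j) v * (D j - D i)) ≤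
      ∑ j, ∑ i, s j * s i * (pair (ξ j) (roeVel (U j) (U i)) * (D j - D i)
        + jumpSpeed (U j) (U i) * (A j + A i)) :=
    Finset.sum_le_sum fun j _ => Finset.sum_le_sum fun i _ =>
      mul_le_mul_of_nonneg_left (pair_mul_sub_le (hξ j) (hU j) (hU i) v b)
        (mul_nonneg (hs j) (hs i))
  -- the terms with `D i` and `A i` are renamed by exchanging the summation indices
  have hR : ∑ j, ∑ i, s j * s i * (pair (ξ j) (roeVel (U j) (U i)) * (D j - D i)
        + jumpSpeed (U j) (U i) * (A j + A i))
      = ∑ j, ∑ i, s j * s i * (pair (ξ j - ξ i) (roeVel (U j) (U i)) * D j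
        + 2 * (jumpSpeed (U j) (U i) * A j)) := by
    have hswap : ∑ j, ∑ i, s j * s i * (-(pair (ξ j) (roeVel (U j) (U i)) * D i)
          + jumpSpeed (U j) (U i) * A i)
        = ∑ j, ∑ i, s j * s i * (-(pair (ξ i) (roeVel (U j) (U i)) * D j)
          + jumpSpeed (U j) (U i) * A j) := by
      rw [Finset.sum_comm]
      refine Finset.sum_congr rfl fun j _ => Finset.sum_congr rfl fun i _ => ?_
      rw [roeVel_comm (U i), jumpSpeed_comm (U i)]
      ring
    have e1 : ∑ j, ∑ i, s j * s i * (pair (ξ j) (roeVel (U j) (U i)) * (D j - D i)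
          + jumpSpeed (U j) (U i) * (A j + A i))
        = ∑ j, ∑ i, s j * s i * (pair (ξ j) (roeVel (U j) (U i)) * D j
            + jumpSpeed (U j) (U i) * A j)
          + ∑ j, ∑ i, s j * s i * (-(pair (ξ j) (roeVel (U j) (U i)) * D i)
            + jumpSpeed (U j) (U i) * A i) := by
      simp only [← Finset.sum_add_distrib]
      exact Finset.sum_congr rfl fun j _ => Finset.sum_congr rfl fun i _ => by ring
    rw [e1, hswap]
    simp only [← Finset.sum_add_distrib, pair_sub_left]
    exact Finset.sum_congr rfl fun j _ => Finset.sum_congr rfl fun i _ => by ring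
  have hfin : T * ∑ j, s j * (1 / T * (∑ i, s i * pair (ξ j - ξ i) (roeVel (U j) (U i))) * D j
        + 2 / T * (∑ i, s i * jumpSpeed (U j) (U i)) * A j)
      = ∑ j, ∑ i, s j * s i * (pair (ξ j - ξ i) (roeVel (U j) (U i)) * D j
        + 2 * (jumpSpeed (U j) (U i) * A j)) := by
    rw [Finset.mul_sum]
    refine Finset.sum_congr rfl fun j _ => ?_
    have : T * (s j * (1 / T * (∑ i, s i * pair (ξ j - ξ i) (roeVel (U j) (U i))) * D j
        + 2 / T * (∑ i, s i * jumpSpeed (U j) (U i)) * A j))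
        = s j * D j * (∑ i, s i * pair (ξ j - ξ i) (roeVel (U j) (U i)))
          + 2 * s j * A j * ∑ i, s i * jumpSpeed (U j) (U i) := by
      field_simp
    rw [this, Finset.mul_sum, Finset.mul_sum, ← Finset.sum_add_distrib]
    exact Finset.sum_congr rfl fun i _ => by ring
  refine le_of_mul_le_mul_left ?_ hs0
  rw [hL, hfin, ← hR]
  exact hle

/-- The quantity `\hat α` for arbitrary weighted directions. -/
def closedAlpha {κ : Type*} [Fintype κ] (p : ℝ → ℝ → ℝ) (s : κ → ℝ) (ξ : κ → Plane)
    (U : κ → State) (j : κ) : ℝ :=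
  waveC p (U j) (ξ j) + 2 / (∑ i, s i) * ∑ i, s i * jumpSpeed (U j) (U i)
    + max (pair (ξ j) (vel (U j)))
        (1 / (∑ i, s i) * ∑ i, s i * pair (ξ j - ξ i) (roeVel (U j) (U i)))

theorem sum_testFunctional_normalFlux_le {p : ℝ → ℝ → ℝ} (hp : IsEOS p) {κ : Type*} [Fintype κ]
    {s : κ → ℝ} {ξ : κ → Plane} {U : κ → State} (hs : ∀ j, 0 ≤ s j) (hs0 : 0 < ∑ j, s j)
    (hξ : ∀ j, ‖ξ j‖ = 1) (hsum : ∑ j, s j • ξ j = 0) (hU : ∀ j, U j ∈ admissible)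
    (v b : Vec3) :
    ∑ j, s j * testFunctional v b (normalFlux p (ξ j) (U j)) ≤
      ∑ j, s j * (closedAlpha p s ξ U j * relativeEnergy v b (U j)
        + inner ℝ v b * pair (ξ j) (mag (U j))) := by
  have h1 : ∑ j, s j * testFunctional v b (normalFlux p (ξ j) (U j)) ≤
      ∑ j, s j * (pair (ξ j) (vel (U j))
          * (dens (U j) * ‖vel (U j) - v‖ ^ 2 / 2 + internalEnergy (U j))
        + waveC p (U j) (ξ j) * relativeEnergy v b (U j)
        + inner ℝ v b * pair (ξ j) (mag (U j)))
      + ∑ j, s j * (pair (ξ j) v * (‖mag (U j) - b‖ ^ 2 / 2))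
      - ∑ j, s j * pair (ξ j) v * (‖b‖ ^ 2 / 2) := by
    rw [← Finset.sum_add_distrib, ← Finset.sum_sub_distrib]
    refine Finset.sum_le_sum fun j _ => ?_
    have := mul_le_mul_of_nonneg_left (testFunctional_normalFlux_le hp (hξ j) (hU j) v b) (hs j)
    linarith
  have h2 := sum_pair_mul_le hs hs0 hξ hsum hU v b
  rw [← Finset.sum_mul, sum_mul_pair, hsum, pair_zero_left, zero_mul, sub_zero] at h1
  refine h1.trans ((add_le_add_right h2 _).trans ?_)
  rw [← Finset.sum_add_distrib]
  refine Finset.sum_le_sum fun j _ => ?_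
  rw [← mul_add]
  refine mul_le_mul_of_nonneg_left ?_ (hs j)
  have h3 := convection_le_max (hU j) v b (pair (ξ j) (vel (U j)))
    (1 / (∑ i, s i) * ∑ i, s i * pair (ξ j - ξ i) (roeVel (U j) (U i)))
  rw [closedAlpha, add_mul, add_mul]
  linarith

/-! ### Geometry of a cell -/

theorem PolygonalCell.len_pos (K : PolygonalCell) (j : Fin K.n) : 0 < K.len j := by
  refine dist_pos.2 fun h => ?_
  have := (K.simple j j 0 (by norm_num) (1 / 2) (by norm_num) (by
    rw [edgePoint, edgePoint, ← h, AffineMap.lineMap_same_apply, AffineMap.lineMap_same_apply])).2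
  norm_num at this

theorem PolygonalCell.perimeter_pos (K : PolygonalCell) : 0 < K.perimeter :=
  Finset.sum_pos (fun j _ => K.len_pos j) ⟨⟨0, by have := K.three_le; omega⟩, Finset.mem_univ _⟩

theorem PolygonalCell.area_pos (K : PolygonalCell) : 0 < K.area := by
  refine ENNReal.toReal_pos ?_ K.isCompact_region.measure_lt_top.ne
  exact (Measure.measure_pos_of_nonempty_interior _ K.nonempty_interior).ne'

theorem PolygonalCell.len_smul_normal (K : PolygonalCell) (j : Fin K.n) :
    K.len j • K.normal j = !₂[K.vertex (finRotate K.n j) 1 - K.vertex j 1,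
      -(K.vertex (finRotate K.n j) 0 - K.vertex j 0)] :=
  smul_inv_smul₀ (K.len_pos j).ne' _

theorem PolygonalCell.norm_normal (K : PolygonalCell) (j : Fin K.n) : ‖K.normal j‖ = 1 := by
  have h : ‖K.len j • K.normal j‖ = K.len j := by
    rw [K.len_smul_normal, len, edgeLength, EuclideanSpace.dist_eq, EuclideanSpace.norm_eq]
    simp only [Fin.sum_univ_two, Real.dist_eq, Real.norm_eq_abs, sq_abs]
    congr 1
    simp
    ring
  rw [norm_smul, Real.norm_eq_abs, abs_of_pos (K.len_pos j)] at h
  exact (mul_eq_left₀ (K.len_pos j).ne').1 h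

/-- The sum telescopes along the closed polygon. -/
theorem PolygonalCell.sum_len_smul_normal (K : PolygonalCell) :
    ∑ j, K.len j • K.normal j = 0 := by
  have hrot : ∀ i : Fin 2, ∑ j, (K.vertex (finRotate K.n j) i - K.vertex j i) = 0 := fun i => by
    rw [Finset.sum_sub_distrib, Equiv.sum_comp (finRotate K.n) fun j => K.vertex j i, sub_self]
  simp only [K.len_smul_normal]
  ext i
  fin_cases i
  · simpa using hrot 1
  · simpa using neg_eq_zero.2 (hrot 0)

/-! ### Quadrature of the cell averages -/

theorem continuous_polyEval (P : MvPolynomial (Fin 2) ℝ) : Continuous (polyEval P) := by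
  unfold polyEval
  have := MvPolynomial.continuous_eval P
  exact this.comp (by fun_prop)

theorem IsPoly.continuous {k : ℕ} {f : Plane → ℝ} (hf : IsPoly k f) : Continuous f := by
  obtain ⟨P, -, h⟩ := hf
  rw [funext h]
  exact continuous_polyEval P

theorem IsPolyState.continuous {k : ℕ} {u : Plane → State} (hu : IsPolyState k u) :
    Continuous u := by
  obtain ⟨h1, h2, h3, h4⟩ := hu
  have hmom : Continuous fun x => mom (u x) :=
    (PiLp.continuous_toLp 2 (fun _ : Fin 3 => ℝ)).comp (continuous_pi fun i => (h2 i).continuous)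
  have hmag : Continuous fun x => mag (u x) :=
    (PiLp.continuous_toLp 2 (fun _ : Fin 3 => ℝ)).comp (continuous_pi fun i => (h3 i).continuous)
  exact h1.continuous.prodMk (hmom.prodMk (hmag.prodMk h4.continuous))

variable {ι : Type*} {M : Mesh ι} {k Q : ℕ} {R : EdgeQuadrature M k Q}

theorem CellQuadrature.integral_isPoly (S : CellQuadrature R) (K : ι) {f : Plane → ℝ}
    (hf : IsPoly k f) :
    (M.cell K).area⁻¹ * ∫ x in (M.cell K).region, f x
      = (∑ j, ∑ q, S.w K j q * f (R.pt K j q)) + ∑ q, S.w' K q * f (S.pt' K q) := by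
  obtain ⟨P, hP, h⟩ := hf
  simp only [h]
  exact S.exact_cell K P hP

theorem CellQuadrature.sum_weights (S : CellQuadrature R) (K : ι) :
    (∑ j, ∑ q, S.w K j q) + ∑ q, S.w' K q = 1 := by
  have h := S.integral_isPoly K (f := fun _ => 1)
    ⟨1, by simp, fun x => by simp [polyEval]⟩
  have harea := (M.cell K).area_pos
  simpa [PolygonalCell.area, harea.ne', inv_mul_cancel₀ (show
    volume.real (M.cell K).region ≠ 0 from harea.ne')] using h.symm

theorem EdgeQuadrature.sum_weights (R : EdgeQuadrature M k Q) (K : ι) : ∑ q, R.ω q = 1 := by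
  have h := R.exact_edge K ⟨0, by have := (M.cell K).three_le; omega⟩ 1 (by simp)
  simpa [polyEval] using h.symm

theorem CellQuadrature.cellAverage_eq (S : CellQuadrature R) (K : ι) {u : Plane → State}
    (hu : IsPolyState k u) :
    cellAverage (M.cell K) u
      = (∑ j, ∑ q, S.w K j q • u (R.pt K j q)) + ∑ q, S.w' K q • u (S.pt' K q) := by
  have hint : IntegrableOn u (M.cell K).region :=
    hu.continuous.continuousOn.integrableOn_compact (M.cell K).isCompact_region
  have key : ∀ L : State →L[ℝ] ℝ, IsPoly k (fun x => L (u x)) →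
      L (cellAverage (M.cell K) u)
        = L ((∑ j, ∑ q, S.w K j q • u (R.pt K j q)) + ∑ q, S.w' K q • u (S.pt' K q)) := by
    intro L hL
    rw [cellAverage, map_smul, ← L.integral_comp_comm hint, smul_eq_mul, S.integral_isPoly K hL]
    simp only [map_add, map_sum, map_smul, smul_eq_mul]
  obtain ⟨h1, h2, h3, h4⟩ := hu
  refine Prod.ext ?_ (Prod.ext ?_ (Prod.ext ?_ ?_))
  · exact key (.fst ℝ ℝ _) h1
  · ext i
    exact key ((EuclideanSpace.proj i).comp ((ContinuousLinearMap.fst ℝ Vec3 (Vec3 × ℝ)).comp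
      (.snd ℝ ℝ _))) (h2 i)
  · ext i
    exact key ((EuclideanSpace.proj i).comp ((ContinuousLinearMap.fst ℝ Vec3 ℝ).comp
      ((ContinuousLinearMap.snd ℝ Vec3 (Vec3 × ℝ)).comp (.snd ℝ ℝ _)))) (h3 i)
  · exact key ((ContinuousLinearMap.snd ℝ Vec3 ℝ).comp
      ((ContinuousLinearMap.snd ℝ Vec3 (Vec3 × ℝ)).comp (.snd ℝ ℝ _))) h4

/-! ### Positivity of functionals of the new cell average -/

/-- If the two-state inequality `hdiff` holds for a linear functional `φ`, the HLL flux
is bounded by the flux of the left state, since `σ⁺U⁺ - F(U⁺) - (σ⁻U⁻ - F(U⁻))` behaves like an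
admissible state. -/
theorem hllFlux_functional_le {p : ℝ → ℝ → ℝ} {σ : WaveSpeeds} {U V : State} {ξ : Plane}
    (hσ : σ.SpeedCondition p U V ξ) (φ : State →ₗ[ℝ] ℝ) (κ τ : ℝ)
    (hU : 0 ≤ φ U + κ) (hV : 0 ≤ φ V + κ)
    (hdiff : φ (normalFlux p ξ V) - φ (normalFlux p ξ U) ≤
      alphaR p V U ξ * (φ V + κ) - alphaL p U V ξ * (φ U + κ)
        + τ * (pair ξ (mag V) - pair ξ (mag U))) :
    φ (hllFlux p σ U V ξ) ≤ φ (normalFlux p ξ U) - σ.minus U V ξ * (φ U + κ)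
      + τ * (pair ξ ((σ.plus U V ξ - σ.minus U V ξ)⁻¹ •
          (σ.plus U V ξ • mag U - σ.minus U V ξ • mag V)) - pair ξ (mag U)) := by
  obtain ⟨hlt, hR, hL⟩ := hσ
  have hp1 : alphaR p V U ξ ≤ σ.plus U V ξ := hR.trans (le_max_left _ _)
  have hm1 : σ.minus U V ξ ≤ alphaL p U V ξ := (min_le_left _ _).trans hL
  have hm0 : σ.minus U V ξ ≤ 0 := min_le_right _ _
  have hd : 0 < σ.plus U V ξ - σ.minus U V ξ :=
    sub_pos.2 (((min_le_left _ _).trans_lt hlt).trans_le (le_max_left _ _))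
  rw [hllFlux]
  simp only [map_smul, map_add, map_sub, smul_eq_mul, pair_smul, pair_sub]
  set sp := σ.plus U V ξ
  set sm := σ.minus U V ξ
  refine le_of_mul_le_mul_left ?_ hd
  have e1 := mul_inv_cancel_left₀ hd.ne' (sp * φ (normalFlux p ξ U) - sm * φ (normalFlux p ξ V)
    + sm * sp * (φ V - φ U))
  have e2 := mul_inv_cancel_left₀ hd.ne' (sp * pair ξ (mag U) - sm * pair ξ (mag V))
  have h1 := mul_le_mul_of_nonneg_right hp1 hV
  have h2 := mul_le_mul_of_nonneg_right hm1 hU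
  have h3 := mul_le_mul_of_nonneg_left (hdiff.trans
    (show _ ≤ sp * (φ V + κ) - sm * (φ U + κ) + τ * (pair ξ (mag V) - pair ξ (mag U)) by linarith))
    (neg_nonneg.2 hm0)
  rw [e1]
  have e3 : (sp - sm) * (φ (normalFlux p ξ U) - sm * (φ U + κ)
      + τ * ((sp - sm)⁻¹ * (sp * pair ξ (mag U) - sm * pair ξ (mag V)) - pair ξ (mag U)))
      = (sp - sm) * φ (normalFlux p ξ U) - (sp - sm) * sm * (φ U + κ)
        + τ * (sp * pair ξ (mag U) - sm * pair ξ (mag V) - (sp - sm) * pair ξ (mag U)) := by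
    linear_combination τ * e2
  rw [e3]
  linarith

theorem GridData.int_mem_admissible {D : GridData M Q} (S : CellQuadrature R)
    (hadm : ∀ K, ∀ x ∈ S.nodes K, D.U K x ∈ admissible) (K : ι) (j : Fin (M.cell K).n)
    (q : Fin Q) : D.int R K j q ∈ admissible :=
  hadm K _ (Or.inr ⟨j, q, rfl⟩)

theorem GridData.ext_mem_admissible {D : GridData M Q} (S : CellQuadrature R)
    (hadm : ∀ K, ∀ x ∈ S.nodes K, D.U K x ∈ admissible)
    (hbdry : ∀ K j, M.adjacent K j = none → ∀ q, D.bdry K j q ∈ admissible)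
    (K : ι) (j : Fin (M.cell K).n) (q : Fin Q) : D.ext R K j q ∈ admissible := by
  rcases h : M.adjacent K j with _ | ⟨K', j'⟩
  · simpa [GridData.ext, h] using hbdry K j h q
  · obtain ⟨q', hq, -⟩ := R.shared K j K' j' h q
    simpa [GridData.ext, h] using hadm K' _ (Or.inr ⟨j', q', hq⟩)

theorem alphaHat_eq (p : ℝ → ℝ → ℝ) (D : GridData M Q) (K : ι) (j : Fin (M.cell K).n)
    (q : Fin Q) : alphaHat p D R K j q
      = closedAlpha p (M.cell K).len (M.cell K).normal (fun i => D.int R K i q) j := rfl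

/-- The common argument for density and energy: an affine functional `φ + κ` which is positive on
admissible states, and whose flux obeys the closed-polygon inequality `hsum` and the two-state
inequality `hdiff`, is positive at the new cell average up to the divergence term. -/
theorem newAverage_functional_pos {p : ℝ → ℝ → ℝ} (S : CellQuadrature R) {D : GridData M Q}
    {σ : WaveSpeeds} {Δt : ℝ} (hΔt : 0 < Δt) (K : ι) (hpoly : IsPolyState k (D.U K))
    (hadm : ∀ K, ∀ x ∈ S.nodes K, D.U K x ∈ admissible)
    (hbdry : ∀ K j, M.adjacent K j = none → ∀ q, D.bdry K j q ∈ admissible)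
    (hspeed : ∀ j q, σ.SpeedCondition p (D.int R K j q) (D.ext R K j q) ((M.cell K).normal j))
    (hCFL : ∀ j q, Δt * ((M.cell K).len j / (M.cell K).area)
          * (alphaHat p D R K j q - sigmaMinus σ D R K j q) < S.w K j q / R.ω q)
    (φ : State →ₗ[ℝ] ℝ) (κ τ : ℝ) (hpos : ∀ U ∈ admissible, 0 < φ U + κ)
    (hsum : ∀ q, ∑ j, (M.cell K).len j * φ (normalFlux p ((M.cell K).normal j) (D.int R K j q)) ≤
      ∑ j, (M.cell K).len j * (alphaHat p D R K j q * (φ (D.int R K j q) + κ)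
        + τ * pair ((M.cell K).normal j) (mag (D.int R K j q))))
    (hdiff : ∀ ξ : Plane, ‖ξ‖ = 1 → ∀ U ∈ admissible, ∀ V ∈ admissible,
      φ (normalFlux p ξ V) - φ (normalFlux p ξ U) ≤
        alphaR p V U ξ * (φ V + κ) - alphaL p U V ξ * (φ U + κ)
          + τ * (pair ξ (mag V) - pair ξ (mag U))) :
    0 < φ (newAverage p σ D R Δt K) + κ + Δt * τ * discreteDiv σ D R K := by
  have harea := (M.cell K).area_pos
  set a := (M.cell K).area with ha
  set s := (M.cell K).len with hs
  set ξ := (M.cell K).normal with hξ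
  set Φ : Fin (M.cell K).n → Fin Q → ℝ := fun j q => φ (D.int R K j q) + κ with hΦ
  have hΦpos : ∀ j q, 0 < Φ j q := fun j q =>
    hpos _ (GridData.int_mem_admissible S hadm K j q)
  set β : Fin (M.cell K).n → Fin Q → ℝ := fun j q =>
    pair (ξ j) ((sigmaPlus σ D R K j q - sigmaMinus σ D R K j q)⁻¹ •
        (sigmaPlus σ D R K j q • mag (D.int R K j q)
          - sigmaMinus σ D R K j q • mag (D.ext R K j q))) with hβ
  have hflux : ∑ j, ∑ q, s j * R.ω q * φ (hllFlux p σ (D.int R K j q) (D.ext R K j q) (ξ j)) ≤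
      ∑ j, ∑ q, s j * R.ω q * ((alphaHat p D R K j q - sigmaMinus σ D R K j q) * Φ j q
        + τ * β j q) := by
    rw [Finset.sum_comm, Finset.sum_comm (s := Finset.univ (α := Fin (M.cell K).n))]
    refine Finset.sum_le_sum fun q _ => ?_
    have h1 : ∀ j, s j * R.ω q * φ (hllFlux p σ (D.int R K j q) (D.ext R K j q) (ξ j)) ≤
        R.ω q * (s j * φ (normalFlux p (ξ j) (D.int R K j q)))
          + s j * R.ω q * (-sigmaMinus σ D R K j q * Φ j q
            + τ * (β j q - pair (ξ j) (mag (D.int R K j q)))) := fun j => by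
      have hU := GridData.int_mem_admissible S hadm K j q
      have hV := GridData.ext_mem_admissible S hadm hbdry K j q
      have h := hllFlux_functional_le (hspeed j q) φ κ τ (hpos _ hU).le (hpos _ hV).le
        (hdiff _ ((M.cell K).norm_normal j) _ hU _ hV)
      have h' := mul_le_mul_of_nonneg_left h
        (mul_nonneg ((M.cell K).len_pos j).le (R.ω_pos q).le)
      refine h'.trans (le_of_eq ?_)
      simp only [hβ, hΦ, sigmaPlus, sigmaMinus]
      ring
    refine (Finset.sum_le_sum fun j _ => h1 j).trans ?_
    rw [Finset.sum_add_distrib, ← Finset.mul_sum]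
    refine (add_le_add_left (mul_le_mul_of_nonneg_left (hsum q) (R.ω_pos q).le) _).trans ?_
    rw [Finset.mul_sum, ← Finset.sum_add_distrib]
    refine Finset.sum_le_sum fun j _ => le_of_eq ?_
    simp only [hΦ]
    ring
  have hnew : φ (newAverage p σ D R Δt K) + κ = (∑ j, ∑ q, S.w K j q * Φ j q)
      + (∑ q, S.w' K q * (φ (D.U K (S.pt' K q)) + κ)) - Δt / a * ∑ j, ∑ q,
        s j * R.ω q * φ (hllFlux p σ (D.int R K j q) (D.ext R K j q) (ξ j)) := by
    rw [newAverage, S.cellAverage_eq K hpoly]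
    simp only [map_sub, map_add, map_sum, map_smul, smul_eq_mul, hΦ, mul_add,
      Finset.sum_add_distrib, ← Finset.sum_mul]
    have := S.sum_weights K
    simp only [GridData.int]
    linear_combination (-κ) * this
  have hdiv : Δt * τ * discreteDiv σ D R K = Δt / a * ∑ j, ∑ q, s j * R.ω q * (τ * β j q) := by
    have : ∑ j, ∑ q, s j * R.ω q * (τ * β j q) = τ * ∑ j, ∑ q, s j * R.ω q * β j q := by
      simp only [Finset.mul_sum]
      exact Finset.sum_congr rfl fun j _ => Finset.sum_congr rfl fun q _ => by ring
    rw [this, discreteDiv]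
    ring
  have hnodes : 0 ≤ ∑ q, S.w' K q * (φ (D.U K (S.pt' K q)) + κ) :=
    Finset.sum_nonneg fun q _ => mul_nonneg (S.w'_pos K q).le
      (hpos _ (hadm K _ (Or.inl ⟨q, rfl⟩))).le
  -- the edge quadrature has at least one point because it integrates the constant `1`
  have hQ : (Finset.univ : Finset (Fin Q)).Nonempty := by
    by_contra h
    have h1 := R.sum_weights K
    rw [Finset.not_nonempty_iff_eq_empty.1 h] at h1
    simp at h1
  have hn : (Finset.univ : Finset (Fin (M.cell K).n)).Nonempty :=
    ⟨⟨0, by have := (M.cell K).three_le; omega⟩, Finset.mem_univ _⟩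
  have hstrict : 0 < ∑ j, ∑ q, (S.w K j q
      - Δt / a * (s j * R.ω q * (alphaHat p D R K j q - sigmaMinus σ D R K j q))) * Φ j q := by
    refine Finset.sum_pos (fun j _ => Finset.sum_pos (fun q _ => mul_pos ?_ (hΦpos j q)) hQ) hn
    have h := (lt_div_iff₀ (R.ω_pos q)).1 (hCFL j q)
    refine sub_pos.2 (lt_of_eq_of_lt ?_ h)
    ring
  have hsplit : ∑ j, ∑ q, (S.w K j q
      - Δt / a * (s j * R.ω q * (alphaHat p D R K j q - sigmaMinus σ D R K j q))) * Φ j q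
      = (∑ j, ∑ q, S.w K j q * Φ j q) - Δt / a * (∑ j, ∑ q, s j * R.ω q *
          ((alphaHat p D R K j q - sigmaMinus σ D R K j q) * Φ j q + τ * β j q))
        + Δt / a * ∑ j, ∑ q, s j * R.ω q * (τ * β j q) := by
    simp only [Finset.mul_sum, ← Finset.sum_add_distrib, ← Finset.sum_sub_distrib]
    exact Finset.sum_congr rfl fun j _ => Finset.sum_congr rfl fun q _ => by ring
  have h := mul_le_mul_of_nonneg_left hflux (div_pos hΔt harea).le
  rw [hnew, hdiv]
  linarith

/-- The density as a linear functional. -/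
def densityFunctional : State →ₗ[ℝ] ℝ := LinearMap.fst ℝ ℝ _

theorem le_closedAlpha {κ : Type*} [Fintype κ] (p : ℝ → ℝ → ℝ) {s : κ → ℝ} (hs : ∀ j, 0 ≤ s j)
    (ξ : κ → Plane) (U : κ → State) (j : κ) :
    pair (ξ j) (vel (U j)) ≤ closedAlpha p s ξ U j := by
  have h1 := waveC_nonneg p (U j) (ξ j)
  have h2 : 0 ≤ 2 / (∑ i, s i) * ∑ i, s i * jumpSpeed (U j) (U i) := by
    have h3 : 0 ≤ ∑ i, s i := Finset.sum_nonneg fun i _ => hs i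
    have h4 : 0 ≤ ∑ i, s i * jumpSpeed (U j) (U i) :=
      Finset.sum_nonneg fun i _ => mul_nonneg (hs i) (by unfold jumpSpeed; positivity)
    positivity
  refine (le_max_left _ _).trans (le_add_of_nonneg_left (add_nonneg h1 h2))

theorem pair_vel_le_alphaR (p : ℝ → ℝ → ℝ) (U V : State) (ξ : Plane) :
    pair ξ (vel U) ≤ alphaR p U V ξ := by
  have h1 := waveC_nonneg p U ξ
  have h2 : 0 ≤ ‖mag U - mag V‖ / (√(dens U) + √(dens V)) := by positivity
  have h3 := le_max_left (pair ξ (vel U)) (pair ξ (roeVel U V))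
  unfold alphaR
  linarith

theorem alphaL_le_pair_vel (p : ℝ → ℝ → ℝ) (U V : State) (ξ : Plane) :
    alphaL p U V ξ ≤ pair ξ (vel U) := by
  have h1 := waveC_nonneg p U ξ
  have h2 : 0 ≤ ‖mag U - mag V‖ / (√(dens U) + √(dens V)) := by positivity
  have h3 := min_le_left (pair ξ (vel U)) (pair ξ (roeVel U V))
  unfold alphaL
  linarith

/-- The values of the test functional are smallest, and equal to the internal energy up to a
constant, if `v` and `b` are the velocity and the magnetic field of the state itself. -/
theorem testFunctional_self {U : State} (hU : 0 < dens U) :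
    testFunctional (vel U) (mag U) U + ‖mag U‖ ^ 2 / 2 = internalEnergy U := by
  rw [testFunctional_add hU, relativeEnergy]
  simp

end MHD

end

theorem theorem4p3 {ι : Type*} (p : ℝ → ℝ → ℝ) (hp : MHD.IsEOS p)
    (M : MHD.Mesh ι) (k Q : ℕ) (R : MHD.EdgeQuadrature M k Q) (S : MHD.CellQuadrature R)
    (D : MHD.GridData M Q) (σ : MHD.WaveSpeeds) (Δt : ℝ) (hΔt : 0 < Δt)
    (hpoly : ∀ K, MHD.IsPolyState k (D.U K))
    (hadm : ∀ K, ∀ x ∈ S.nodes K, D.U K x ∈ MHD.admissible)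
    (hbdry : ∀ K j, M.adjacent K j = none → ∀ q, D.bdry K j q ∈ MHD.admissible)
    (hspeed : ∀ K j q,
      σ.SpeedCondition p (D.int R K j q) (D.ext R K j q) ((M.cell K).normal j))
    (hCFL : ∀ K j q,
      Δt * ((M.cell K).len j / (M.cell K).area)
          * (MHD.alphaHat p D R K j q - MHD.sigmaMinus σ D R K j q)
        < S.w K j q / R.ω q) :
    ∀ K,
      0 < MHD.dens (MHD.newAverage p σ D R Δt K) ∧
      MHD.internalEnergy (MHD.newAverage p σ D R Δt K)
        > -Δt * (MHD.dens (MHD.newAverage p σ D R Δt K))⁻¹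
            * inner ℝ (MHD.mom (MHD.newAverage p σ D R Δt K))
                (MHD.mag (MHD.newAverage p σ D R Δt K))
            * MHD.discreteDiv σ D R K ∧
      (MHD.discreteDiv σ D R K = 0 → MHD.newAverage p σ D R Δt K ∈ MHD.admissible) := by
  open MHD in
  intro K
  have hint : ∀ j q, D.int R K j q ∈ admissible := GridData.int_mem_admissible S hadm K
  have hlen : ∀ j, 0 ≤ (M.cell K).len j := fun j => ((M.cell K).len_pos j).le
  have hdens : 0 < dens (newAverage p σ D R Δt K) := by
    have h := newAverage_functional_pos S hΔt K (hpoly K) hadm hbdry (hspeed K) (hCFL K)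
      densityFunctional 0 0 (fun U hU => hU.1.trans_eq (add_zero _).symm)
      (fun q => Finset.sum_le_sum fun j _ => mul_le_mul_of_nonneg_left ?_ (hlen j))
      (fun ξ _ U hU V hV => ?_)
    · rw [add_zero, mul_zero, zero_mul, add_zero] at h
      exact h
    · have h1 := mul_le_mul_of_nonneg_right
        (le_closedAlpha p hlen (M.cell K).normal (fun i => D.int R K i q) j) (hint j q).1.le
      rw [← alphaHat_eq] at h1
      rw [zero_mul, add_zero, add_zero]
      refine le_trans (le_of_eq ?_) h1
      exact dens_normalFlux.trans (mul_comm _ _)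
    · have h1 := mul_le_mul_of_nonneg_right (pair_vel_le_alphaR p V U ξ) hV.1.le
      have h2 := mul_le_mul_of_nonneg_right (alphaL_le_pair_vel p U V ξ) hU.1.le
      change dens (normalFlux p ξ V) - dens (normalFlux p ξ U)
        ≤ alphaR p V U ξ * (dens V + 0) - alphaL p U V ξ * (dens U + 0) + _
      rw [dens_normalFlux, dens_normalFlux]
      linarith
  have henergy : internalEnergy (newAverage p σ D R Δt K)
        > -Δt * (dens (newAverage p σ D R Δt K))⁻¹
            * inner ℝ (mom (newAverage p σ D R Δt K)) (mag (newAverage p σ D R Δt K))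
            * discreteDiv σ D R K := by
    set v := vel (newAverage p σ D R Δt K) with hv
    set b := mag (newAverage p σ D R Δt K) with hb
    have h := newAverage_functional_pos S hΔt K (hpoly K) hadm hbdry (hspeed K) (hCFL K)
      (testFunctional v b) (‖b‖ ^ 2 / 2) (inner ℝ v b)
      (fun U hU => by rw [testFunctional_add hU.1]; exact relativeEnergy_pos hU v b)
      (fun q => ?_) (fun ξ hξ U hU V hV => ?_)
    · rw [hv, hb, testFunctional_self hdens, ← hb, vel, inner_smul_left] at h
      simp only [conj_trivial] at h
      linarith
    · simp only [testFunctional_add (hint _ q).1, alphaHat_eq]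
      exact sum_testFunctional_normalFlux_le hp hlen (M.cell K).perimeter_pos
        (M.cell K).norm_normal (M.cell K).sum_len_smul_normal (fun j => hint j q) v b
    · rw [testFunctional_add hU.1, testFunctional_add hV.1]
      exact testFunctional_flux_difference_le hp hξ hU hV v b
  refine ⟨hdens, henergy, fun hdiv => ⟨hdens, ?_⟩⟩
  simpa [hdiv] using henergy
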